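/- All vector spaces are real. A curve $c:\mathbb R\to E$ into a Hausdorff locally convex space $E$ is smooth if all its iterated derivatives exist and are continuous; $E$ is convenient if every smooth curve in $E$ has a smooth antiderivative; a map between open subsets of convenient spaces is smooth if it maps smooth curves to smooth curves. Let $M$ be a (possibly infinite-dimensional) manifold modelled on a convenient space $E$: a topological space with an atlas of homeomorphisms onto open subsets of $E$ whose transition maps are smooth in this sense. Tangent vectors are velocities of smooth curves, and $k$-forms are smooth, fibrewise (separately) continuous, multilinear and alternating. A closed $2$-form $\omega$ on $M$ is weakly symplectic if for every $p\in M$ and $v\in T_pM$, $\omega_p(v,\cdot)=0$ implies $v=0$. For a $1$-form $\eta$ on such a manifold put $\mathrm{Hor}=\ker\eta$, $\mathrm{Ver}=\ker(v\mapsto d\eta(v,\cdot))$ and $\flat(v)=\iota_v d\eta+\eta(v)\eta$. The form $\eta$ is a (weakly) contact form if $d\eta$ has non-zero kernel at every point and the following conditions, which are equivalent for such $\eta$, hold at every point: (1) the tangent space is $\mathrm{Hor}\oplus\mathrm{Ver}$; (2) $d\eta|_{\mathrm{Hor}}$ has zero kernel; (3) $\flat$ is injective. A Reeb field of $\eta$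 is a smooth vector field $R$ with $\eta(R)=1$ and $\iota_R d\eta=0$. Theorem. Let $\theta$ be a $1$-form on $M$ such that $d\theta$ is weakly symplectic. Let $N$ be either $\mathbb R$ or a circle $S^1=\mathbb R/T\mathbb Z$ ($T>0$), with its coordinate $z$ and the $1$-form $dz$, and let $\pi_1,\pi_2$ be the projections of $N\times M$ onto $N$ and $M$. Then $N\times M$ is a manifold modelled on the convenient space $\mathbb R\times E$, the form $\eta=\pi_1^*dz+\pi_2^*\theta$ is a contact form on $N\times M$ (it satisfies all of (1)-(3)), and $\partial/\partial z$ is its unique Reeb field. -/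

import Mathlib

open Filter Topology Set

noncomputable section

namespace ConvenientContact

/-! ## Calculus along smooth curves -/

section Calculus

variable {E : Type*} [AddCommGroup E] [Module ℝ E] [TopologicalSpace E]
variable {F : Type*} [AddCommGroup F] [Module ℝ F] [TopologicalSpace F]

/-- The curve `c` is differentiable at time `t` with derivative `v`. -/
def HasVelocity (c : ℝ → E) (v : E) (t : ℝ) : Prop :=
  Tendsto (fun δ : ℝ => δ⁻¹ • (c (t + δ) - c t)) (𝓝[≠] 0) (𝓝 v)

/-- The derivative `c'(t)` of a curve (meaningful when the limit exists). -/
def velocity (c : ℝ → E) (t : ℝ) : E :=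
  limUnder (𝓝[≠] (0 : ℝ)) (fun δ : ℝ => δ⁻¹ • (c (t + δ) - c t))

/-- `c : ℝ → E` is a smooth curve: all iterated derivatives `d n = c⁽ⁿ⁾` exist everywhere
(they are then automatically continuous). -/
def IsSmoothCurve (c : ℝ → E) : Prop :=
  ∃ d : ℕ → ℝ → E, d 0 = c ∧ ∀ n t, HasVelocity (d n) (d (n + 1) t) t

/-- `f` is smooth on `U` in the sense of convenient calculus: it maps smooth curves in `U` to
smooth curves. -/
def IsSmoothOn (f : E → F) (U : Set E) : Prop :=
  ∀ c : ℝ → E, IsSmoothCurve c → (∀ t, c t ∈ U) → IsSmoothCurve (fun t => f (c t))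

variable (E) in
/-- A convenient vector space: every smooth curve has a smooth antiderivative.  (To be used for
Hausdorff locally convex spaces `E`.) -/
def IsConvenient : Prop :=
  ∀ c : ℝ → E, IsSmoothCurve c → ∃ C : ℝ → E, IsSmoothCurve C ∧ ∀ t, HasVelocity C (c t) t

end Calculus

/-! ## Manifolds modelled on a convenient space, and their product -/

section Manifolds

variable (E : Type*) [AddCommGroup E] [Module ℝ E] [TopologicalSpace E]
variable (M : Type*) [TopologicalSpace M] [ChartedSpace E M]

/-- The atlas makes `M` a manifold modelled on the convenient space `E`: all transition maps are
smooth. -/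
structure IsConvenientManifold : Prop where
  convenient : IsConvenient E
  smooth_transition : ∀ φ ∈ atlas E M, ∀ ψ ∈ atlas E M,
    IsSmoothOn (fun x => ψ (φ.symm x)) (φ.symm.trans ψ).source

end Manifolds

/-- The product manifold `N × M`, modelled on `F × E`, with the products of charts as its charts. -/
instance productChartedSpace (F : Type*) [TopologicalSpace F] (N : Type*) [TopologicalSpace N]
    [ChartedSpace F N] (E : Type*) [TopologicalSpace E] (M : Type*) [TopologicalSpace M]
    [ChartedSpace E M] : ChartedSpace (F × E) (N × M) :=
  prodChartedSpace F N E M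

/-- The circle `S¹ = ℝ / Tℤ` of length `T > 0` as a one-dimensional manifold: the charts are the
inverses of the quotient map restricted to the intervals `(a, a + T)`. -/
instance circleChartedSpace (T : ℝ) [hT : Fact (0 < T)] : ChartedSpace ℝ (AddCircle T) where
  atlas := Set.range fun a : ℝ => (AddCircle.openPartialHomeomorphCoe T a).symm
  chartAt x := (AddCircle.openPartialHomeomorphCoe T (Quotient.out x - T / 2)).symm
  mem_chart_source x := by
    have h0 : (0 : ℝ) < T := hT.out
    have hx : ((Quotient.out x : ℝ) : AddCircle T) = x := Quotient.out_eq x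
    have h := (AddCircle.openPartialHomeomorphCoe T (Quotient.out x - T / 2)).map_source
      (x := Quotient.out x) ⟨by linarith, by linarith⟩
    have h' : ((Quotient.out x : ℝ) : AddCircle T) ∈
      (AddCircle.openPartialHomeomorphCoe T (Quotient.out x - T / 2)).target := h
    rw [hx] at h'
    exact h'
  chart_mem_atlas x := ⟨_, rfl⟩

/-! ## Tangent vectors, vector fields, differential forms

As usual in Mathlib, the (kinematic) tangent space `T_p M` is identified with the model space `E`
through the preferred chart at `p`: the class of a curve `c` with `c 0 = p` corresponds to the
derivative at `0` of the curve `chartAt E p ∘ c`.  So a field of covectors is a map `M → E → ℝ`,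
whose value at `p : M` is a functional on `T_p M = E`, and similarly for the other tensors. -/

section Tangent

variable {E : Type*} [AddCommGroup E] [Module ℝ E] [TopologicalSpace E]
variable {M : Type*} [TopologicalSpace M] [ChartedSpace E M]
variable {F : Type*} [AddCommGroup F] [Module ℝ F] [TopologicalSpace F]
variable {N : Type*} [TopologicalSpace N] [ChartedSpace F N]

/-- The tangent vector `[c] ∈ T_{c 0} M = E` of a curve `c` in `M`. -/
def tangentVec (c : ℝ → M) : E :=
  velocity (fun t => chartAt E (c 0) (c t)) 0

/-- The curve in `M` that is the line `x + t v` in the chart `φ`. -/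
def chartLine (φ : OpenPartialHomeomorph M E) (x v : E) : ℝ → M :=
  fun t => φ.symm (x + t • v)

/-- The tangent vector at `φ⁻¹ x` whose coordinates in the chart `φ` are `v`. -/
def chartVec (φ : OpenPartialHomeomorph M E) (x v : E) : E :=
  tangentVec (chartLine φ x v)

/-- The tangent map `T_p f : T_p M → T_{f p} N`. -/
def kinTangentMap (f : M → N) (p : M) (v : E) : F :=
  tangentVec (fun t => f (chartLine (chartAt E p) (chartAt E p p) v t))

/-- The local representative of a vector field in a chart. -/
def vectorRep (X : M → E) (φ : OpenPartialHomeomorph M E) (x : E) : E :=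
  velocity (fun t => φ (chartLine (chartAt E (φ.symm x))
    (chartAt E (φ.symm x) (φ.symm x)) (X (φ.symm x)) t)) 0

/-- A (smooth, kinematic) vector field. -/
def IsVectorField (X : M → E) : Prop :=
  ∀ φ ∈ atlas E M, IsSmoothOn (vectorRep X φ) φ.target

/-- The local representative of a 1-form in a chart. -/
def formRep (α : M → E → ℝ) (φ : OpenPartialHomeomorph M E) (x v : E) : ℝ :=
  α (φ.symm x) (chartVec φ x v)

/-- The local representative of a 2-form in a chart. -/
def formRep₂ (ω : M → E → E → ℝ) (φ : OpenPartialHomeomorph M E) (x v w : E) : ℝ :=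
  ω (φ.symm x) (chartVec φ x v) (chartVec φ x w)

/-- `α` is a (smooth, kinematic) 1-form on `M`. -/
structure IsOneForm (α : M → E → ℝ) : Prop where
  linear : ∀ p, IsLinearMap ℝ (α p)
  continuous : ∀ p, Continuous (α p)
  smooth : ∀ φ ∈ atlas E M,
    IsSmoothOn (fun y : E × E => formRep α φ y.1 y.2) (φ.target ×ˢ univ)

/-- `ω` is a (smooth, kinematic) 2-form on `M`. -/
structure IsTwoForm (ω : M → E → E → ℝ) : Prop where
  linear : ∀ p v, IsLinearMap ℝ (ω p v)
  continuous : ∀ p v, Continuous (ω p v)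
  antisymm : ∀ p v w, ω p v w = -ω p w v
  smooth : ∀ φ ∈ atlas E M,
    IsSmoothOn (fun y : E × E × E => formRep₂ ω φ y.1 y.2.1 y.2.2) (φ.target ×ˢ univ)

/-- The pull-back `f^* α` of a 1-form. -/
def pullback (f : M → N) (α : N → F → ℝ) : M → E → ℝ :=
  fun p v => α (f p) (kinTangentMap f p v)

/-- The exterior derivative of a 1-form, in the chart at `p`:
`dα(v, w) = D_v (α(w)) - D_w (α(v))` for constant `v`, `w`. -/
def extDeriv₁ (α : M → E → ℝ) : M → E → E → ℝ :=
  fun p v w =>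
    deriv (fun t : ℝ => formRep α (chartAt E p) (chartAt E p p + t • v) w) 0
      - deriv (fun t : ℝ => formRep α (chartAt E p) (chartAt E p p + t • w) v) 0

/-- The exterior derivative of a 2-form, in the chart at `p`:
`dω(u, v, w) = D_u (ω(v, w)) - D_v (ω(u, w)) + D_w (ω(u, v))` for constant `u`, `v`, `w`. -/
def extDeriv₂ (ω : M → E → E → ℝ) : M → E → E → E → ℝ :=
  fun p u v w =>
    deriv (fun t : ℝ => formRep₂ ω (chartAt E p) (chartAt E p p + t • u) v w) 0
      - deriv (fun t : ℝ => formRep₂ ω (chartAt E p) (chartAt E p p + t • v) u w) 0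
      + deriv (fun t : ℝ => formRep₂ ω (chartAt E p) (chartAt E p p + t • w) u v) 0

/-! ## Weakly symplectic forms, contact forms, Reeb fields -/

/-- `ω` is a weakly symplectic form: a closed 2-form with `ω_p(v, ·) = 0` only for `v = 0`. -/
structure IsWeaklySymplectic (ω : M → E → E → ℝ) : Prop where
  twoForm : IsTwoForm ω
  closed : ∀ p u v w, extDeriv₂ ω p u v w = 0
  nondegenerate : ∀ p v, (∀ w, ω p v w = 0) → v = 0

/-- The horizontal distribution `ker η`. -/
def Hor (η : M → E → ℝ) (p : M) : Set E :=
  {v | η p v = 0}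

/-- The vertical distribution `ker dη`. -/
def Ver (η : M → E → ℝ) (p : M) : Set E :=
  {v | ∀ w, extDeriv₁ η p v w = 0}

/-- The map `♭ v = ι_v dη + η(v) η`. -/
def flat (η : M → E → ℝ) (p : M) (v : E) : E → ℝ :=
  fun w => extDeriv₁ η p v w + η p v * η p w

/-- `η` is a (weakly) contact form: a 1-form with `dη` degenerate at each point, that satisfies
the following three conditions (which are equivalent to each other for such 1-forms; all of them
are included):  `TM = Hor ⊕ Ver`;  `dη` is weakly non-degenerate on `Hor`;  `♭` is injective on
the tangent spaces. -/
structure IsContactForm (η : M → E → ℝ) : Prop where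
  oneForm : IsOneForm η
  twoForm : IsTwoForm (extDeriv₁ η)
  degenerate : ∀ p, ∃ v ∈ Ver η p, v ≠ 0
  whitney_sum : ∀ p, ∃ H V : Submodule ℝ E,
    (H : Set E) = Hor η p ∧ (V : Set E) = Ver η p ∧ IsCompl H V
  nondegenerate : ∀ p, ∀ v ∈ Hor η p, (∀ w ∈ Hor η p, extDeriv₁ η p v w = 0) → v = 0
  flat_injective : ∀ p, Function.Injective (flat η p)

/-- `R` is a Reeb vector field of `η`: `ι_R η = 1` and `ι_R dη = 0`. -/
structure IsReebField (η : M → E → ℝ) (R : M → E) : Prop where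
  vectorField : IsVectorField R
  apply_eq_one : ∀ p, η p (R p) = 1
  contract_eq_zero : ∀ p w, extDeriv₁ η p (R p) w = 0

end Tangent

/-! ## The forms on the products -/

/-- The 1-form `dz` on a one-dimensional manifold `N` all of whose charts differ locally by
translations, so that they define a coordinate `z` up to constants.  Used for `N = ℝ` and
for the circle. -/
def dz (N : Type*) : N → ℝ → ℝ :=
  fun _ ζ => ζ

/-- The 1-form `η = π₁^* dz + π₂^* θ` on `N × M`. -/
def contactization (N : Type*) [TopologicalSpace N] [ChartedSpace ℝ N]
    {E : Type*} [AddCommGroup E] [Module ℝ E] [TopologicalSpace E]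
    {M : Type*} [TopologicalSpace M] [ChartedSpace E M] (θ : M → E → ℝ) :
    N × M → ℝ × E → ℝ :=
  fun q u => pullback (Prod.fst : N × M → N) (dz N) q u
    + pullback (Prod.snd : N × M → M) θ q u

/-- The vector field `∂/∂z` on `N × M`, where `T_{(z, p)} (N × M) = ℝ × T_p M`. -/
def partialZ (N : Type*) (M : Type*) (E : Type*) [AddCommGroup E] : N × M → ℝ × E :=
  fun _ => (1, 0)

end ConvenientContact

end

open ConvenientContact

namespace ConvenientContact

/-! ## Velocities and smooth curves -/

section Curves

variable {E : Type*} [AddCommGroup E] [Module ℝ E] [TopologicalSpace E]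
variable {F : Type*} [AddCommGroup F] [Module ℝ F] [TopologicalSpace F]

/-! The coordinate on `N` is defined up to constants, so on `T(N × M) = ℝ × TM` the form is `η(a, v)
= a + θ(v)`. The coefficient of `a` is constant in charts, hence `dη((a, v), (b, w)) = dθ(v, w)`. As
`dθ` is weakly nondegenerate, `Ver` is the line `ℝ × 0`, while `Hor` is the graph of `-θ`. The two
are complementary, and projecting `Hor` onto `TM` carries `dη` to `dθ`. A Reeb field lies in `Ver`
with `η = 1`, so it is `∂/∂z`.

Both choices of `N` enter only through `HasTranslationCharts`. The analytic work is to justify these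
formulas when tangent vectors are limits taken in charts: `chartVec_prod` splits tangent vectors,
`extDeriv₁_contactization` computes `dη`, and `mem_Ver_contactization` finds its kernel. The rest is
linear algebra. -/

theorem HasVelocity.velocity_eq [T2Space E] {c : ℝ → E} {v : E} {t : ℝ}
    (h : HasVelocity c v t) : velocity c t = v :=
  Tendsto.limUnder_eq h

theorem HasVelocity.congr {c c' : ℝ → E} {v : E} {t : ℝ} (h : HasVelocity c v t)
    (hc : ∀ᶠ s in 𝓝 t, c s = c' s) : HasVelocity c' v t := by
  refine Tendsto.congr' ?_ h
  have ht : Tendsto (fun δ : ℝ => t + δ) (𝓝 0) (𝓝 t) := by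
    simpa using (by fun_prop : Continuous fun δ : ℝ => t + δ).tendsto 0
  filter_upwards [(ht.eventually hc).filter_mono nhdsWithin_le_nhds] with δ hδ
  rw [hδ, hc.self_of_nhds]

theorem HasVelocity.add_const {c : ℝ → E} {v : E} {t : ℝ} (h : HasVelocity c v t) (k : E) :
    HasVelocity (fun s => c s + k) v t := by
  simpa [HasVelocity] using h

theorem HasVelocity.prodMk {c : ℝ → E} {b : ℝ → F} {v : E} {w : F} {t : ℝ}
    (hc : HasVelocity c v t) (hb : HasVelocity b w t) :
    HasVelocity (fun s => (c s, b s)) (v, w) t :=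
  Tendsto.prodMk_nhds hc hb

theorem HasVelocity.fst {c : ℝ → E × F} {v : E × F} {t : ℝ} (h : HasVelocity c v t) :
    HasVelocity (fun s => (c s).1) v.1 t :=
  (continuous_fst.tendsto v).comp h

theorem HasVelocity.snd {c : ℝ → E × F} {v : E × F} {t : ℝ} (h : HasVelocity c v t) :
    HasVelocity (fun s => (c s).2) v.2 t :=
  (continuous_snd.tendsto v).comp h

theorem HasVelocity.add [ContinuousAdd E] {c b : ℝ → E} {v w : E} {t : ℝ}
    (hc : HasVelocity c v t) (hb : HasVelocity b w t) :
    HasVelocity (fun s => c s + b s) (v + w) t := by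
  refine (Tendsto.add hc hb).congr fun δ => ?_
  rw [← smul_add, add_sub_add_comm]

theorem hasVelocity_const (e : E) (t : ℝ) : HasVelocity (fun _ => e) 0 t := by
  simp [HasVelocity, tendsto_const_nhds]

theorem hasVelocity_iff_hasDerivAt {c : ℝ → ℝ} {v t : ℝ} :
    HasVelocity c v t ↔ HasDerivAt c v t :=
  hasDerivAt_iff_tendsto_slope_zero.symm

theorem HasVelocity.smul_const [ContinuousSMul ℝ E] {r : ℝ → ℝ} {s t : ℝ}
    (h : HasVelocity r s t) (v : E) : HasVelocity (fun a => r a • v) (s • v) t := by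
  refine (Tendsto.smul_const h v).congr fun δ => ?_
  rw [smul_assoc, sub_smul]

theorem hasVelocity_line [ContinuousSMul ℝ E] (x v : E) :
    HasVelocity (fun t : ℝ => x + t • v) v 0 := by
  have h : HasVelocity (fun t : ℝ => t) 1 0 := hasVelocity_iff_hasDerivAt.2 (hasDerivAt_id 0)
  simpa [add_comm] using (h.smul_const v).add_const x

theorem IsSmoothCurve.prodMk {c : ℝ → E} {b : ℝ → F} (hc : IsSmoothCurve c)
    (hb : IsSmoothCurve b) : IsSmoothCurve (fun t => (c t, b t)) := by
  obtain ⟨d, rfl, hd⟩ := hc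
  obtain ⟨e, rfl, he⟩ := hb
  exact ⟨fun n t => (d n t, e n t), rfl, fun n t => (hd n t).prodMk (he n t)⟩

theorem IsSmoothCurve.fst {c : ℝ → E × F} (hc : IsSmoothCurve c) :
    IsSmoothCurve (fun t => (c t).1) := by
  obtain ⟨d, rfl, hd⟩ := hc
  exact ⟨fun n t => (d n t).1, rfl, fun n t => (hd n t).fst⟩

theorem IsSmoothCurve.snd {c : ℝ → E × F} (hc : IsSmoothCurve c) :
    IsSmoothCurve (fun t => (c t).2) := by
  obtain ⟨d, rfl, hd⟩ := hc
  exact ⟨fun n t => (d n t).2, rfl, fun n t => (hd n t).snd⟩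

theorem IsSmoothCurve.add [ContinuousAdd E] {c b : ℝ → E} (hc : IsSmoothCurve c)
    (hb : IsSmoothCurve b) : IsSmoothCurve (fun t => c t + b t) := by
  obtain ⟨d, rfl, hd⟩ := hc
  obtain ⟨e, rfl, he⟩ := hb
  exact ⟨fun n t => d n t + e n t, rfl, fun n t => (hd n t).add (he n t)⟩

theorem isSmoothCurve_const (e : E) : IsSmoothCurve (fun _ : ℝ => e) := by
  refine ⟨fun n _ => if n = 0 then e else 0, by simp, fun n t => ?_⟩
  simpa using hasVelocity_const _ t

theorem isSmoothCurve_line_comp [ContinuousSMul ℝ E] {r : ℝ → ℝ} (hr : ContDiff ℝ (⊤ : ℕ∞) r)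
    (x v : E) : IsSmoothCurve (fun t => x + r t • v) := by
  -- The base point contributes only to the derivative of order zero.
  refine ⟨fun n t => (if n = 0 then x else 0) + iteratedDeriv n r t • v, by simp, fun n t => ?_⟩
  have h : HasDerivAt (iteratedDeriv n r) (iteratedDeriv (n + 1) r t) t := by
    rw [iteratedDeriv_succ]
    exact (hr.differentiable_iteratedDeriv n (by exact_mod_cast WithTop.coe_lt_top _) t).hasDerivAt
  simpa [add_comm] using
    ((hasVelocity_iff_hasDerivAt.2 h).smul_const v).add_const (if n = 0 then x else 0)

/-- Smooth maps have directional derivatives. -/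
theorem IsSmoothOn.exists_hasVelocity_line [IsTopologicalAddGroup E] [ContinuousSMul ℝ E]
    {f : E → F} {U : Set E} (hf : IsSmoothOn f U) (hU : IsOpen U) {x : E} (hx : x ∈ U) (v : E) :
    ∃ u, HasVelocity (fun t : ℝ => f (x + t • v)) u 0 := by
  have hcont : Continuous fun t : ℝ => x + t • v := by fun_prop
  have hmem : (fun t : ℝ => x + t • v) ⁻¹' U ∈ 𝓝 (0 : ℝ) :=
    (hU.preimage hcont).mem_nhds (by simpa using hx)
  obtain ⟨ε, hε, hball⟩ := Metric.mem_nhds_iff.1 hmem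
  -- The line may leave `U`, but smoothness of `f` is tested only on curves defined on all of `ℝ`
  -- inside `U`. Reparametrising by `t * b t` keeps the curve in the part of the line over the
  -- `ε`-ball and changes nothing near `0`.
  let b : ContDiffBump (0 : ℝ) := ⟨ε / 2, ε, by linarith, by linarith⟩
  have hr : ContDiff ℝ (⊤ : ℕ∞) fun t : ℝ => t * b t := contDiff_id.mul b.contDiff
  have hrU : ∀ t, x + (t * b t) • v ∈ U := by
    intro t
    by_cases ht : t ∈ Metric.ball (0 : ℝ) ε
    · refine hball (?_ : t * b t ∈ Metric.ball (0 : ℝ) ε)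
      rw [mem_ball_zero_iff, Real.norm_eq_abs] at ht ⊢
      rw [abs_mul, abs_of_nonneg (b.nonneg' t)]
      exact (mul_le_of_le_one_right (abs_nonneg t) b.le_one).trans_lt ht
    · have h0 : b t = 0 := b.zero_of_le_dist (not_lt.1 ht)
      simpa [h0] using hx
  obtain ⟨d, hd0, hd⟩ := hf _ (isSmoothCurve_line_comp hr x v) hrU
  refine ⟨d 1 0, (hd0 ▸ hd 0 0 : HasVelocity _ (d 1 0) 0).congr ?_⟩
  filter_upwards [b.eventuallyEq_one] with t ht
  simp [ht]

theorem isConvenient_real : IsConvenient ℝ := by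
  rintro _ ⟨d, rfl, hd⟩
  have hc : Continuous (d 0) :=
    continuous_iff_continuousAt.2 fun t => (hasVelocity_iff_hasDerivAt.1 (hd 0 t)).continuousAt
  have hC : ∀ t, HasVelocity (fun s => ∫ a in (0 : ℝ)..s, d 0 a) (d 0 t) t := fun t =>
    hasVelocity_iff_hasDerivAt.2 (hc.integral_hasStrictDerivAt 0 t).hasDerivAt
  refine ⟨_, ⟨fun n => n.casesOn (fun s => ∫ a in (0 : ℝ)..s, d 0 a) d, rfl, ?_⟩, hC⟩
  rintro (_ | n) t
  · exact hC t
  · exact hd n t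

theorem IsConvenient.prod (hE : IsConvenient E) (hF : IsConvenient F) :
    IsConvenient (E × F) := by
  intro c hc
  obtain ⟨A, hA, hA'⟩ := hE _ hc.fst
  obtain ⟨B, hB, hB'⟩ := hF _ hc.snd
  exact ⟨_, hA.prodMk hB, fun t => (hA' t).prodMk (hB' t)⟩

end Curves

/-! ## One-dimensional manifolds with a coordinate up to constants -/

/-- All transition maps of the one-dimensional manifold `N` are locally translations. -/
def HasTranslationCharts (N : Type*) [TopologicalSpace N] [ChartedSpace ℝ N] : Prop :=
  ∀ φ ∈ atlas ℝ N, ∀ ψ ∈ atlas ℝ N, ∀ x ∈ (φ.symm.trans ψ).source,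
    ∃ k : ℝ, ∀ᶠ y in 𝓝 x, ψ (φ.symm y) = y + k

theorem hasTranslationCharts_real : HasTranslationCharts ℝ := by
  intro φ hφ ψ hψ x _
  rw [chartedSpaceSelf_atlas] at hφ hψ
  subst hφ hψ
  exact ⟨0, by simp⟩

/-- A transition map `χ` lifts the identity of the circle, so `χ y - y` changes only by multiples of
`T`; continuity makes the change smaller than `T` near `x`, hence zero. -/
theorem hasTranslationCharts_circle (T : ℝ) [hT : Fact (0 < T)] :
    HasTranslationCharts (AddCircle T) := by
  rintro _ ⟨a, rfl⟩ _ ⟨b, rfl⟩ x hx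
  set ψ := (AddCircle.openPartialHomeomorphCoe T b).symm
  set χ := (AddCircle.openPartialHomeomorphCoe T a).symm.symm.trans ψ
  change ∃ k : ℝ, ∀ᶠ y in 𝓝 x, χ y = y + k
  have hlift : ∀ y ∈ χ.source, ((χ y : ℝ) : AddCircle T) = y := by
    intro y hy
    rw [OpenPartialHomeomorph.trans_source] at hy
    exact ψ.left_inv hy.2
  have hcont : ContinuousAt (fun y => χ y - y) x :=
    (χ.continuousAt hx).sub continuousAt_id
  refine ⟨χ x - x, ?_⟩
  filter_upwards [hcont.eventually (Metric.ball_mem_nhds _ hT.out),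
    χ.open_source.mem_nhds hx] with y hy hys
  have hzero : ((χ y - y - (χ x - x) : ℝ) : AddCircle T) = 0 := by
    simp [hlift y hys, hlift x hx]
  obtain ⟨n, hn⟩ := (AddCircle.coe_eq_zero_iff T).1 hzero
  rw [dist_eq_norm, ← hn, zsmul_eq_mul, norm_mul, Real.norm_of_nonneg hT.out.le,
    mul_lt_iff_lt_one_left hT.out, Int.norm_cast_real, Int.norm_eq_abs] at hy
  have hn0 : n = 0 := Int.abs_lt_one_iff.1 (by exact_mod_cast hy)
  rw [hn0, zero_smul] at hn
  linarith

section Translation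

variable {N : Type*} [TopologicalSpace N] [ChartedSpace ℝ N]

/-- Local translations alter a curve only by locally constant terms, so every derivative of order at
least one is unchanged. -/
theorem HasTranslationCharts.isSmoothOn (hN : HasTranslationCharts N)
    {φ ψ : OpenPartialHomeomorph N ℝ} (hφ : φ ∈ atlas ℝ N) (hψ : ψ ∈ atlas ℝ N) :
    IsSmoothOn (fun x => ψ (φ.symm x)) (φ.symm.trans ψ).source := by
  rintro _ ⟨d, rfl, hd⟩ hU
  refine ⟨fun n => n.casesOn (fun t => ψ (φ.symm (d 0 t))) fun m => d (m + 1), rfl, ?_⟩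
  rintro (_ | n) t
  · obtain ⟨k, hk⟩ := hN φ hφ ψ hψ _ (hU t)
    refine ((hd 0 t).add_const k).congr ?_
    filter_upwards [(hasVelocity_iff_hasDerivAt.1 (hd 0 t)).continuousAt.eventually hk] with s hs
    exact hs.symm
  · exact hd (n + 1) t

theorem HasTranslationCharts.hasVelocity_line (hN : HasTranslationCharts N)
    {φ ψ : OpenPartialHomeomorph N ℝ} (hφ : φ ∈ atlas ℝ N) (hψ : ψ ∈ atlas ℝ N)
    {x : ℝ} (hx : x ∈ (φ.symm.trans ψ).source) (v : ℝ) :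
    HasVelocity (fun t : ℝ => ψ (φ.symm (x + t • v))) v 0 := by
  obtain ⟨k, hk⟩ := hN φ hφ ψ hψ x hx
  have hcont : Tendsto (fun t : ℝ => x + t • v) (𝓝 0) (𝓝 x) := by
    simpa using (by fun_prop : Continuous fun t : ℝ => x + t • v).tendsto 0
  refine ((ConvenientContact.hasVelocity_line x v).add_const k).congr ?_
  filter_upwards [hcont.eventually hk] with t ht
  exact ht.symm

end Translation

/-! ## Charts and tangent vectors of the product -/

section Charts

variable {E : Type*} [TopologicalSpace E] {M : Type*} [TopologicalSpace M] [ChartedSpace E M]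

theorem mem_trans_chartAt_source {φ : OpenPartialHomeomorph M E} {x : E} (hx : x ∈ φ.target) :
    x ∈ (φ.symm.trans (chartAt E (φ.symm x))).source := by
  rw [OpenPartialHomeomorph.trans_source]
  exact ⟨hx, mem_chart_source E _⟩

theorem chartAt_mem_trans_source {φ : OpenPartialHomeomorph M E} {p : M} (hp : p ∈ φ.source) :
    chartAt E p p ∈ ((chartAt E p).symm.trans φ).source := by
  rw [OpenPartialHomeomorph.trans_source]
  refine ⟨mem_chart_target E p, ?_⟩
  simpa using hp

end Charts

section Product

variable {E : Type*} [AddCommGroup E] [Module ℝ E] [TopologicalSpace E]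
variable {M : Type*} [TopologicalSpace M] [ChartedSpace E M]

theorem chartVec_eq (φ : OpenPartialHomeomorph M E) (x v : E) :
    chartVec φ x v =
      velocity (fun t : ℝ => chartAt E (φ.symm x) (φ.symm (x + t • v))) 0 := by
  simp only [chartVec, tangentVec, chartLine, zero_smul, add_zero]

theorem IsTwoForm.sub_left {ω : M → E → E → ℝ} (hω : IsTwoForm ω) (p : M) (u v w : E) :
    ω p (u - v) w = ω p u w - ω p v w := by
  rw [hω.antisymm, (hω.linear p w).map_sub, hω.antisymm p u, hω.antisymm p v]
  ring

theorem eventually_line_mem [ContinuousSMul ℝ E] [IsTopologicalAddGroup E]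
    {U : Set E} (hU : IsOpen U) {x : E} (hx : x ∈ U) (v : E) :
    ∀ᶠ t : ℝ in 𝓝 0, x + t • v ∈ U :=
  (hU.preimage (by fun_prop : Continuous fun t : ℝ => x + t • v)).mem_nhds (by simpa using hx)

/-- Read in the preferred chart, the curve is the line itself for small `t`. This makes the
identification of `T_p M` with `E` consistent. -/
theorem tangentVec_chartLine_chartAt [T2Space E] [ContinuousSMul ℝ E] [IsTopologicalAddGroup E]
    (p : M) (v : E) :
    tangentVec (chartLine (chartAt E p) (chartAt E p p) v) = v := by
  have h0 : chartLine (chartAt E p) (chartAt E p p) v 0 = p := by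
    simp [chartLine]
  refine HasVelocity.velocity_eq ?_
  rw [h0]
  refine (hasVelocity_line (chartAt E p p) v).congr ?_
  filter_upwards [eventually_line_mem (chartAt E p).open_target (mem_chart_target E p) v]
    with t ht
  exact ((chartAt E p).right_inv ht).symm

variable {N : Type*} [TopologicalSpace N] [ChartedSpace ℝ N]

theorem isConvenientManifold_prod (hN : HasTranslationCharts N) (hM : IsConvenientManifold E M) :
    IsConvenientManifold (ℝ × E) (N × M) := by
  refine ⟨isConvenient_real.prod hM.convenient, ?_⟩
  rintro _ ⟨φ₁, hφ₁, φ₂, hφ₂, rfl⟩ _ ⟨ψ₁, hψ₁, ψ₂, hψ₂, rfl⟩ c hc hU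
  have hU' : ∀ t, (c t).1 ∈ (φ₁.symm.trans ψ₁).source ∧ (c t).2 ∈ (φ₂.symm.trans ψ₂).source := by
    intro t
    obtain ⟨h1, h2⟩ := hU t
    exact ⟨⟨h1.1, h2.1⟩, ⟨h1.2, h2.2⟩⟩
  exact (hN.isSmoothOn hφ₁ hψ₁ _ hc.fst fun t => (hU' t).1).prodMk
    (hM.smooth_transition φ₂ hφ₂ ψ₂ hψ₂ _ hc.snd fun t => (hU' t).2)

/-- The preferred chart at `q` is by definition the product of the preferred charts, so a chart line
in `N × M` projects to a chart line in `N`. -/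
theorem kinTangentMap_fst (q : N × M) (u : ℝ × E) :
    kinTangentMap (Prod.fst : N × M → N) q u = u.1 :=
  tangentVec_chartLine_chartAt q.1 u.1

theorem isVectorField_partialZ [T2Space E] (hN : HasTranslationCharts N) :
    IsVectorField (E := ℝ × E) (partialZ N M E) := by
  rintro _ ⟨φ₁, hφ₁, φ₂, hφ₂, rfl⟩ c _ hU
  -- Translations have derivative `1`, and the `M`-component of the defining curve stands still, so
  -- the representative is constant in every product chart.
  have heq : ∀ t, vectorRep (partialZ N M E) (φ₁.prod φ₂) (c t) = (1, 0) := by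
    intro t
    obtain ⟨h1, h2⟩ : (c t).1 ∈ φ₁.target ∧ (c t).2 ∈ φ₂.target := hU t
    refine HasVelocity.velocity_eq ?_
    refine (hN.hasVelocity_line (chart_mem_atlas ℝ (φ₁.symm (c t).1)) hφ₁
      (chartAt_mem_trans_source (φ₁.map_target h1)) 1).prodMk ?_
    change HasVelocity (fun s : ℝ => φ₂ ((chartAt E (φ₂.symm (c t).2)).symm
      (chartAt E (φ₂.symm (c t).2) (φ₂.symm (c t).2) + s • (0 : E)))) 0 0
    simp only [smul_zero]
    exact hasVelocity_const _ 0
  simp only [heq]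
  exact isSmoothCurve_const _

variable [ContinuousSMul ℝ E] [IsTopologicalAddGroup E]

theorem IsConvenientManifold.exists_hasVelocity_line (hM : IsConvenientManifold E M)
    {φ ψ : OpenPartialHomeomorph M E} (hφ : φ ∈ atlas E M) (hψ : ψ ∈ atlas E M)
    {x : E} (hx : x ∈ (φ.symm.trans ψ).source) (v : E) :
    ∃ u, HasVelocity (fun t : ℝ => ψ (φ.symm (x + t • v))) u 0 :=
  (hM.smooth_transition φ hφ ψ hψ).exists_hasVelocity_line (φ.symm.trans ψ).open_source hx v

variable [T2Space E]

/-- The velocity of a pair can be computed componentwise once both limits exist: translation charts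
give the first, smoothness of the transition maps of `M` the second. -/
theorem chartVec_prod (hN : HasTranslationCharts N) (hM : IsConvenientManifold E M)
    {φ₁ : OpenPartialHomeomorph N ℝ} {φ₂ : OpenPartialHomeomorph M E}
    (hφ₁ : φ₁ ∈ atlas ℝ N) (hφ₂ : φ₂ ∈ atlas E M) {x : ℝ × E}
    (hx₁ : x.1 ∈ φ₁.target) (hx₂ : x.2 ∈ φ₂.target) (v : ℝ × E) :
    chartVec (M := N × M) (φ₁.prod φ₂) x v = (v.1, chartVec φ₂ x.2 v.2) := by
  have h1 := hN.hasVelocity_line hφ₁ (chart_mem_atlas ℝ _) (mem_trans_chartAt_source hx₁) v.1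
  obtain ⟨u, hu⟩ := hM.exists_hasVelocity_line hφ₂ (chart_mem_atlas E _)
    (mem_trans_chartAt_source hx₂) v.2
  have h2 : chartVec φ₂ x.2 v.2 = u := by
    rw [chartVec_eq]
    exact hu.velocity_eq
  rw [h2, chartVec_eq]
  exact (h1.prodMk hu).velocity_eq

theorem kinTangentMap_snd (q : N × M) (u : ℝ × E) :
    kinTangentMap (Prod.snd : N × M → M) q u = u.2 :=
  tangentVec_chartLine_chartAt q.2 u.2

/-! ### The form `η` in coordinates and its exterior derivative -/

theorem contactization_apply (θ : M → E → ℝ) (q : N × M) (u : ℝ × E) :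
    contactization N θ q u = u.1 + θ q.2 u.2 := by
  simp [contactization, pullback, dz, kinTangentMap_fst, kinTangentMap_snd]

theorem formRep_contactization (hN : HasTranslationCharts N) (hM : IsConvenientManifold E M)
    (θ : M → E → ℝ) {φ₁ : OpenPartialHomeomorph N ℝ} {φ₂ : OpenPartialHomeomorph M E}
    (hφ₁ : φ₁ ∈ atlas ℝ N) (hφ₂ : φ₂ ∈ atlas E M) {x : ℝ × E}
    (hx₁ : x.1 ∈ φ₁.target) (hx₂ : x.2 ∈ φ₂.target) (v : ℝ × E) :
    formRep (contactization N θ) (φ₁.prod φ₂) x v = v.1 + formRep θ φ₂ x.2 v.2 := by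
  rw [formRep, chartVec_prod hN hM hφ₁ hφ₂ hx₁ hx₂, contactization_apply]
  rfl

theorem extDeriv₁_contactization (hN : HasTranslationCharts N) (hM : IsConvenientManifold E M)
    (θ : M → E → ℝ) (q : N × M) (u w : ℝ × E) :
    extDeriv₁ (contactization N θ) q u w = extDeriv₁ θ q.2 u.2 w.2 := by
  have key : ∀ u w : ℝ × E,
      deriv (fun t : ℝ => formRep (contactization N θ) (chartAt (ℝ × E) q)
        (chartAt (ℝ × E) q q + t • u) w) 0 =
      deriv (fun t : ℝ => formRep θ (chartAt E q.2) (chartAt E q.2 q.2 + t • u.2) w.2) 0 := by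
    intro u w
    rw [← deriv_const_add w.1 (f := fun t : ℝ =>
      formRep θ (chartAt E q.2) (chartAt E q.2 q.2 + t • u.2) w.2)]
    refine Filter.EventuallyEq.deriv_eq ?_
    -- The coordinate formula for `η` holds only over the chart targets, where the line stays for
    -- small `t`.
    filter_upwards [
      eventually_line_mem (chartAt ℝ q.1).open_target (mem_chart_target ℝ q.1) u.1,
      eventually_line_mem (chartAt E q.2).open_target (mem_chart_target E q.2) u.2]
      with t h1 h2
    exact formRep_contactization hN hM θ (chart_mem_atlas ℝ q.1) (chart_mem_atlas E q.2)
      (x := chartAt (ℝ × E) q q + t • u) h1 h2 w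
  rw [extDeriv₁, key, key, extDeriv₁]

theorem isOneForm_contactization (hN : HasTranslationCharts N) (hM : IsConvenientManifold E M)
    {θ : M → E → ℝ} (hθ : IsOneForm θ) : IsOneForm (contactization N θ) where
  linear q := by
    constructor
    · intro u w
      simp only [contactization_apply, Prod.fst_add, Prod.snd_add, (hθ.linear q.2).map_add]
      ring
    · intro a u
      simp only [contactization_apply, Prod.smul_fst, Prod.smul_snd, (hθ.linear q.2).map_smul,
        smul_add]
  continuous q := by
    simp only [funext (contactization_apply θ q)]
    exact continuous_fst.add ((hθ.continuous q.2).comp continuous_snd)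
  smooth := by
    rintro _ ⟨φ₁, hφ₁, φ₂, hφ₂, rfl⟩ c hc hU
    have hmem : ∀ t, (c t).1.1 ∈ φ₁.target ∧ (c t).1.2 ∈ φ₂.target := fun t => (hU t).1
    have heq : ∀ t, formRep (contactization N θ) (φ₁.prod φ₂) (c t).1 (c t).2 =
        (c t).2.1 + formRep θ φ₂ (c t).1.2 (c t).2.2 := fun t =>
      formRep_contactization hN hM θ hφ₁ hφ₂ (hmem t).1 (hmem t).2 _
    simp only [heq]
    exact hc.snd.fst.add (hθ.smooth φ₂ hφ₂ _ (hc.fst.snd.prodMk hc.snd.snd)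
      fun t => ⟨(hmem t).2, mem_univ _⟩)

theorem isTwoForm_extDeriv₁_contactization (hN : HasTranslationCharts N)
    (hM : IsConvenientManifold E M) {θ : M → E → ℝ} (hω : IsTwoForm (extDeriv₁ θ)) :
    IsTwoForm (extDeriv₁ (contactization N θ)) where
  linear q u := by
    constructor
    · intro v w
      simp only [extDeriv₁_contactization hN hM, Prod.snd_add, (hω.linear _ _).map_add]
    · intro a v
      simp only [extDeriv₁_contactization hN hM, Prod.smul_snd, (hω.linear _ _).map_smul]
  continuous q u := by
    simp only [funext (extDeriv₁_contactization hN hM θ q u)]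
    exact (hω.continuous q.2 u.2).comp continuous_snd
  antisymm q u w := by
    simp only [extDeriv₁_contactization hN hM]
    exact hω.antisymm _ _ _
  smooth := by
    rintro _ ⟨φ₁, hφ₁, φ₂, hφ₂, rfl⟩ c hc hU
    have hmem : ∀ t, (c t).1.1 ∈ φ₁.target ∧ (c t).1.2 ∈ φ₂.target := fun t => (hU t).1
    have heq : ∀ t, formRep₂ (extDeriv₁ (contactization N θ)) (φ₁.prod φ₂) (c t).1 (c t).2.1
        (c t).2.2 = formRep₂ (extDeriv₁ θ) φ₂ (c t).1.2 (c t).2.1.2 (c t).2.2.2 := by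
      intro t
      rw [formRep₂, extDeriv₁_contactization hN hM,
        chartVec_prod hN hM hφ₁ hφ₂ (hmem t).1 (hmem t).2,
        chartVec_prod hN hM hφ₁ hφ₂ (hmem t).1 (hmem t).2]
      rfl
    simp only [heq]
    exact hω.smooth φ₂ hφ₂ _ (hc.fst.snd.prodMk (hc.snd.fst.snd.prodMk hc.snd.snd.snd))
      fun t => ⟨(hmem t).2, mem_univ _⟩

/-! ### The kernel of `dη`, the contact conditions and the Reeb field -/

theorem mem_Ver_contactization (hN : HasTranslationCharts N) (hM : IsConvenientManifold E M)
    {θ : M → E → ℝ} (hω : IsWeaklySymplectic (extDeriv₁ θ)) (q : N × M) (u : ℝ × E) :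
    u ∈ Ver (contactization N θ) q ↔ u.2 = 0 := by
  simp only [Ver, mem_ofPred_eq, extDeriv₁_contactization hN hM]
  refine ⟨fun h => hω.nondegenerate q.2 _ fun w => h (0, w), fun h w => ?_⟩
  rw [h, hω.twoForm.antisymm, (hω.twoForm.linear _ _).map_zero, neg_zero]

theorem isContactForm_contactization (hN : HasTranslationCharts N)
    (hM : IsConvenientManifold E M) {θ : M → E → ℝ} (hθ : IsOneForm θ)
    (hω : IsWeaklySymplectic (extDeriv₁ θ)) : IsContactForm (contactization N θ) where
  oneForm := isOneForm_contactization hN hM hθ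
  twoForm := isTwoForm_extDeriv₁_contactization hN hM hω.twoForm
  degenerate q := ⟨(1, 0), (mem_Ver_contactization hN hM hω q _).2 rfl, by simp⟩
  whitney_sum q := by
    let η := (isOneForm_contactization (N := N) hN hM hθ).linear q
    refine ⟨LinearMap.ker η.mk', LinearMap.ker (LinearMap.snd ℝ ℝ E), ?_, ?_, ?_⟩
    · ext u
      rfl
    · ext u
      rw [mem_Ver_contactization hN hM hω]
      rfl
    · rw [isCompl_iff, Submodule.disjoint_def, codisjoint_iff, Submodule.eq_top_iff']
      constructor
      · rintro ⟨a, v⟩ h (rfl : v = 0)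
        have h' : contactization N θ q (a, 0) = 0 := h
        rw [contactization_apply, (hθ.linear _).map_zero, add_zero] at h'
        simp only at h'
        rw [h']
        rfl
      · rintro ⟨a, v⟩
        -- The horizontal part of `(a, v)` is the lift of `v` to the graph of `-θ`; what remains is
        -- vertical.
        refine Submodule.mem_sup.2 ⟨(-θ q.2 v, v), ?_, (a + θ q.2 v, 0), rfl, by simp⟩
        change contactization N θ q _ = 0
        rw [contactization_apply]
        simp
  nondegenerate q u hu h := by
    -- Every `w` in `T_p M` has the horizontal lift `(-θ w, w)`, and `dη` sees only its
    -- `M`-component.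
    have h2 : u.2 = 0 := hω.nondegenerate q.2 _ fun w => by
      rw [← h (-θ q.2 w, w) (by simp [Hor, contactization_apply]),
        extDeriv₁_contactization hN hM]
    have h1 : contactization N θ q u = 0 := hu
    rw [contactization_apply, h2, (hθ.linear _).map_zero, add_zero] at h1
    exact Prod.ext h1 h2
  flat_injective q u v h := by
    have hflat : ∀ w : ℝ × E, extDeriv₁ θ q.2 u.2 w.2 +
        (u.1 + θ q.2 u.2) * (w.1 + θ q.2 w.2) = extDeriv₁ θ q.2 v.2 w.2 +
        (v.1 + θ q.2 v.2) * (w.1 + θ q.2 w.2) := by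
      intro w
      simpa only [flat, extDeriv₁_contactization hN hM, contactization_apply] using congrFun h w
    -- Pairing with `∂/∂z`, where `dη` vanishes and `η` is `1`, recovers `η(u)` from `♭ u`. The
    -- `η`-terms then cancel, leaving an equality of `dθ`-contractions.
    have h1 : u.1 + θ q.2 u.2 = v.1 + θ q.2 v.2 := by
      simpa [(hω.twoForm.linear _ _).map_zero, (hθ.linear _).map_zero] using hflat (1, 0)
    have h2 : u.2 = v.2 := sub_eq_zero.1 <| hω.nondegenerate q.2 _ fun w => by
      have := hflat (0, w)
      rw [h1] at this
      rw [hω.twoForm.sub_left, sub_eq_zero]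
      exact add_right_cancel this
    rw [h2] at h1
    exact Prod.ext (add_right_cancel h1) h2

theorem isReebField_contactization_iff (hN : HasTranslationCharts N)
    (hM : IsConvenientManifold E M) {θ : M → E → ℝ} (hθ : IsOneForm θ)
    (hω : IsWeaklySymplectic (extDeriv₁ θ)) (R : N × M → ℝ × E) :
    IsReebField (contactization N θ) R ↔ R = partialZ N M E := by
  constructor
  · intro h
    funext q
    have h2 : (R q).2 = 0 := (mem_Ver_contactization hN hM hω q _).1 (h.contract_eq_zero q)
    have h1 := h.apply_eq_one q
    rw [contactization_apply, h2, (hθ.linear _).map_zero, add_zero] at h1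
    exact Prod.ext h1 h2
  · rintro rfl
    refine ⟨isVectorField_partialZ hN, fun q => ?_, fun q =>
      (mem_Ver_contactization hN hM hω q _).2 rfl⟩
    simp [contactization_apply, partialZ, (hθ.linear _).map_zero]

end Product

end ConvenientContact

theorem mainTheorem3
    {E : Type*} [AddCommGroup E] [Module ℝ E] [TopologicalSpace E]
    [IsTopologicalAddGroup E] [ContinuousSMul ℝ E] [LocallyConvexSpace ℝ E] [T2Space E]
    {M : Type*} [TopologicalSpace M] [ChartedSpace E M]
    (hM : IsConvenientManifold E M)
    (θ : M → E → ℝ) (hθ : IsOneForm θ) (hω : IsWeaklySymplectic (extDeriv₁ θ))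
    (T : ℝ) [Fact (0 < T)] :
    (IsConvenientManifold (ℝ × E) (ℝ × M) ∧
      IsContactForm (contactization ℝ θ) ∧
      ∀ R : ℝ × M → ℝ × E, IsReebField (contactization ℝ θ) R ↔ R = partialZ ℝ M E) ∧
    (IsConvenientManifold (ℝ × E) (AddCircle T × M) ∧
      IsContactForm (contactization (AddCircle T) θ) ∧
      ∀ R : AddCircle T × M → ℝ × E,
        IsReebField (contactization (AddCircle T) θ) R ↔ R = partialZ (AddCircle T) M E) := by
  exact ⟨⟨isConvenientManifold_prod hasTranslationCharts_real hM,
      isContactForm_contactization hasTranslationCharts_real hM hθ hω,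
      isReebField_contactization_iff hasTranslationCharts_real hM hθ hω⟩,
    ⟨isConvenientManifold_prod (hasTranslationCharts_circle T) hM,
      isContactForm_contactization (hasTranslationCharts_circle T) hM hθ hω,
      isReebField_contactization_iff (hasTranslationCharts_circle T) hM hθ hω⟩⟩
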